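/- Let $G$ be a connected simple graph, finite or infinite, with distance $d_G$, and suppose that $G$ is bipartite. A set $C$ of vertices of $G$ is called convex if it contains every vertex of every shortest $(x,y)$-path of $G$, for all $x,y\in C$. A set $K\subseteq V(G)$ is a copoint at a vertex $x$ (and $x$ is an attaching point of $K$) if $K$ is maximal, with respect to inclusion, among the convex sets that do not contain $x$; $K$ is a copoint if it is a copoint at some vertex, and $\mathrm{Att}(K)$ denotes the set of all attaching points of $K$. The graph $G$ is Att-convex if $\mathrm{Att}(K)$ is convex for every copoint $K$ of $G$. For a set $I$ (finite or infinite), the hypercube over $I$ is the graph whose vertices are the finite subsets of $I$, two of them being adjacent if they differ in exactly one element. The graph $G$ is a partial cube if it is isomorphic to an isometric subgraph of a hypercube, that is, to a connected subgraph $H$ of some hypercube $Q$ such that $d_H(x,y)=d_Q(x,y)$ for all vertices $x,y$ of $H$. Then $G$ is a partial cube if and only if $G$ is Att-convex. -/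

import Mathlib

namespace SimpleGraph

/-- The geodesic interval `I_G(x, y)`: the vertices of all `(x, y)`-geodesics of `G`. -/
def geodInterval {V : Type*} (G : SimpleGraph V) (x y : V) : Set V :=
  {z | ∃ p : G.Walk x y, p.length = G.dist x y ∧ z ∈ p.support}

/-- A set of vertices is (geodesically) convex if it contains the geodesic interval between any
two of its elements. -/
def GeodConvex {V : Type*} (G : SimpleGraph V) (C : Set V) : Prop :=
  ∀ ⦃x⦄, x ∈ C → ∀ ⦃y⦄, y ∈ C → G.geodInterval x y ⊆ C

/-- `K` is a copoint at `x`: a convex set which is maximal with respect to the property of not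
containing `x`. One also says that `x` is an attaching point of `K`. -/
def IsCopointAt {V : Type*} (G : SimpleGraph V) (K : Set V) (x : V) : Prop :=
  Maximal (fun C : Set V => G.GeodConvex C ∧ x ∉ C) K

/-- `K` is a copoint if it is a copoint at some vertex. -/
def IsCopoint {V : Type*} (G : SimpleGraph V) (K : Set V) : Prop :=
  ∃ x, G.IsCopointAt K x

/-- `Att(K)`: the set of all attaching points of `K`. -/
def att {V : Type*} (G : SimpleGraph V) (K : Set V) : Set V :=
  {x | G.IsCopointAt K x}

/-- `G` is Att-convex: the set of attaching points of each copoint is convex. -/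
def AttConvex {V : Type*} (G : SimpleGraph V) : Prop :=
  ∀ K : Set V, G.IsCopoint K → G.GeodConvex (G.att K)

/-- The hypercube over an arbitrary (finite or infinite) index set `ι`: the vertices are the
finite subsets of `ι`, two of them being adjacent when they differ in exactly one element. -/
def hypercube (ι : Type*) : SimpleGraph (Finset ι) where
  Adj s t := ∃! i, ¬(i ∈ s ↔ i ∈ t)
  symm := ⟨fun _ _ ⟨i, hi, hu⟩ => ⟨i, fun h => hi h.symm, fun j hj => hu j fun h => hj h.symm⟩⟩
  loopless := ⟨fun _ ⟨_, hi, _⟩ => hi Iff.rfl⟩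

/-- A connected subgraph `H` of `G` is isometric if distances in `H` agree with those in `G`. -/
def Subgraph.IsIsometric {V : Type*} {G : SimpleGraph V} (H : G.Subgraph) : Prop :=
  H.Connected ∧ ∀ x y : H.verts, H.coe.dist x y = G.dist (x : V) (y : V)

/-- A partial cube is a graph isomorphic to an isometric subgraph of a hypercube. -/
def IsPartialCube.{u} {V : Type u} (G : SimpleGraph V) : Prop :=
  ∃ (ι : Type u) (H : (hypercube ι).Subgraph), H.IsIsometric ∧ Nonempty (G ≃g H.coe)

end SimpleGraph

/-! Both properties are shown equivalent to convexity of all the sets `closerSet a b`, written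
W_{ab}, for edges ab.

In an isometric subgraph of a hypercube, W_{ab} is cut out by one coordinate, so it is convex. If
all W_{ab} are convex, every nonempty copoint is one of them, so copoints have convex complements
and `geodConvex_att` applies. Also, sending x to the set of all W_{ab} that contain x but not a base
vertex o is then an isometric embedding into a hypercube.

It remains to deduce convexity from Att-convexity, by strong induction on the perimeter of the
triple a, x, y (`AttConvex.closersConvexUpTo`). If a geodesic between two vertices x, y of W_{ab}
leaves W_{ab}, it does so along edges uu' and vv', and the triple b, u', v' has smaller perimeter.
If some convex set contains b, u', v' but not a, it extends to a copoint at a to which u and v are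
attached but u' is not, although u' lies between u and v (`AttConvex.false_of_crossing`).

That convex set is built from a closed walk made of three geodesics through the triple. A Crofton
formula holds on the walk: twice the distance of two vertices is the number of edges of the walk
separating them. Each edge separates at most two of the three pairs in a triple, so the formula
keeps all perimeters within the range of the induction hypothesis. This lets it propagate to
intervals, and a maximal set with the formula is convex (`IsGeodesicTriangle.exists_geodConvex`). -/

namespace SimpleGraph

/-! ### Geodesics, the sets W_{ab}, and copoints. -/

section Basic

variable {V : Type*} {G : SimpleGraph V}

theorem Connected.mem_geodInterval_iff (hc : G.Connected) {x y z : V} :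
    z ∈ G.geodInterval x y ↔ G.dist x z + G.dist z y = G.dist x y := by
  constructor
  · rintro ⟨p, hp, hz⟩
    obtain ⟨q, r, rfl⟩ := Walk.mem_support_iff_exists_append.1 hz
    have h1 := dist_le q
    have h2 := dist_le r
    have h3 := hc.dist_triangle (u := x) (v := z) (w := y)
    rw [Walk.length_append] at hp
    omega
  · intro h
    obtain ⟨q, hq⟩ := hc.exists_walk_length_eq_dist x z
    obtain ⟨r, hr⟩ := hc.exists_walk_length_eq_dist z y
    exact ⟨q.append r, by rw [Walk.length_append, hq, hr, h],
      Walk.mem_support_iff_exists_append.2 ⟨q, r, rfl⟩⟩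

theorem Connected.exists_adj_dist_succ (hc : G.Connected) {x y : V} (h : x ≠ y) :
    ∃ z, G.Adj x z ∧ G.dist z y + 1 = G.dist x y := by
  obtain ⟨p, hp⟩ := hc.exists_walk_length_eq_dist x y
  cases p with
  | nil => exact absurd rfl h
  | @cons _ w _ hxz q =>
    refine ⟨w, hxz, ?_⟩
    have h1 := dist_le q
    have h2 := hc.dist_triangle (u := x) (v := w) (w := y)
    rw [dist_eq_one_iff_adj.2 hxz] at h2
    rw [Walk.length_cons] at hp
    omega

/-- A geodesic from a vertex of `S` to a vertex outside `S` uses an edge leaving `S`. -/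
theorem Connected.exists_adj_crossing (hc : G.Connected) (S : Set V) {x z : V} (hx : x ∈ S)
    (hz : z ∉ S) :
    ∃ u ∈ S, ∃ v ∉ S, G.Adj u v ∧ G.dist x u + 1 + G.dist v z = G.dist x z := by
  induction hn : G.dist x z generalizing x with
  | zero =>
    rw [hc.dist_eq_zero_iff] at hn
    exact absurd (hn ▸ hx) hz
  | succ n ih =>
    have hne : x ≠ z := by rintro rfl; exact hz hx
    obtain ⟨y, hxy, hy⟩ := hc.exists_adj_dist_succ hne
    by_cases hyS : y ∈ S
    · obtain ⟨u, hu, v, hv, huv, h⟩ := ih hyS (by omega)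
      refine ⟨u, hu, v, hv, huv, ?_⟩
      have h1 := hc.dist_triangle (u := x) (v := y) (w := u)
      have h2 := hc.dist_triangle (u := x) (v := u) (w := z)
      have h3 := hc.dist_triangle (u := u) (v := v) (w := z)
      rw [dist_eq_one_iff_adj.2 hxy] at h1
      rw [dist_eq_one_iff_adj.2 huv] at h3
      omega
    · exact ⟨x, hx, y, hyS, hxy, by rw [dist_self]; omega⟩

/-- Equal distances would close up to a walk of odd length through the edge. -/
theorem IsBipartite.dist_ne_of_adj (hb : G.IsBipartite) (hc : G.Connected) {a b : V}
    (h : G.Adj a b) (x : V) : G.dist x a ≠ G.dist x b := by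
  intro he
  obtain ⟨p, hp⟩ := hc.exists_walk_length_eq_dist x a
  obtain ⟨q, hq⟩ := hc.exists_walk_length_eq_dist x b
  have := two_colorable_iff_forall_loop_even.1 hb x (p.append (Walk.cons h q.reverse))
  rw [Walk.length_append, Walk.length_cons, Walk.length_reverse, hp, hq, he] at this
  grind

theorem IsBipartite.dist_adj_cases (hb : G.IsBipartite) (hc : G.Connected) {a b : V}
    (h : G.Adj a b) (x : V) :
    G.dist x b = G.dist x a + 1 ∨ G.dist x a = G.dist x b + 1 := by
  have h1 := hc.dist_triangle (u := x) (v := a) (w := b)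
  have h2 := hc.dist_triangle (u := x) (v := b) (w := a)
  rw [dist_eq_one_iff_adj.2 h] at h1
  rw [dist_eq_one_iff_adj.2 h.symm] at h2
  have := hb.dist_ne_of_adj hc h x
  omega

/-- The set `W_{ab}` of the vertices that are closer to `a` than to `b`. -/
def closerSet (G : SimpleGraph V) (a b : V) : Set V :=
  {x | G.dist x a < G.dist x b}

theorem mem_closerSet {a b x : V} : x ∈ G.closerSet a b ↔ G.dist x a < G.dist x b := Iff.rfl

theorem left_mem_closerSet {a b : V} (h : G.Adj a b) : a ∈ G.closerSet a b := by
  rw [mem_closerSet, dist_self, dist_eq_one_iff_adj.2 h]; exact one_pos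

theorem right_notMem_closerSet {a b : V} : b ∉ G.closerSet a b := by
  rw [mem_closerSet, dist_self]; omega

theorem IsBipartite.compl_closerSet (hb : G.IsBipartite) (hc : G.Connected) {a b : V}
    (h : G.Adj a b) : (G.closerSet a b)ᶜ = G.closerSet b a := by
  ext x
  have := hb.dist_ne_of_adj hc h x
  rw [Set.mem_compl_iff, mem_closerSet, mem_closerSet]
  omega

theorem IsBipartite.notMem_closerSet (hb : G.IsBipartite) (hc : G.Connected) {a b x : V}
    (h : G.Adj a b) : x ∉ G.closerSet a b ↔ x ∈ G.closerSet b a := by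
  rw [← hb.compl_closerSet hc h, Set.mem_compl_iff]

theorem IsBipartite.dist_eq_of_mem_closerSet (hb : G.IsBipartite) (hc : G.Connected) {a b x : V}
    (h : G.Adj a b) (hx : x ∈ G.closerSet a b) : G.dist x b = G.dist x a + 1 := by
  have := hb.dist_adj_cases hc h x
  rw [mem_closerSet] at hx
  omega

/-- A convex set that contains exactly the end `a` of an edge `ab` lies in `W_{ab}`. -/
theorem IsBipartite.subset_closerSet (hb : G.IsBipartite) (hc : G.Connected) {a b : V}
    (h : G.Adj a b) {K : Set V} (hK : G.GeodConvex K) (ha : a ∈ K) (hbK : b ∉ K) :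
    K ⊆ G.closerSet a b := by
  intro w hw
  by_contra hn
  have h1 := hb.dist_eq_of_mem_closerSet hc h.symm ((hb.notMem_closerSet hc h).1 hn)
  exact hbK (hK hw ha (hc.mem_geodInterval_iff.2
    (by rw [dist_eq_one_iff_adj.2 h.symm, h1])))

/-- A convex set missing `x` extends to a copoint at `x`. -/
theorem GeodConvex.exists_isCopointAt {T : Set V} (hT : G.GeodConvex T) {x : V} (hx : x ∉ T) :
    ∃ K, T ⊆ K ∧ G.IsCopointAt K x := by
  refine zorn_subset_nonempty {C | G.GeodConvex C ∧ x ∉ C} ?_ T ⟨hT, hx⟩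
  intro c hcS hch hne
  refine ⟨⋃₀ c, ⟨?_, ?_⟩, fun s hs => Set.subset_sUnion_of_mem hs⟩
  · rintro u ⟨s, hs, hu⟩ v ⟨t, ht, hv⟩ z hz
    rcases hch.total hs ht with hst | hts
    · exact ⟨t, ht, (hcS ht).1 (hst hu) hv hz⟩
    · exact ⟨s, hs, (hcS hs).1 hu (hts hv) hz⟩
  · rintro ⟨s, hs, hxs⟩
    exact (hcS hs).2 hxs

/-- If the complement of a copoint is convex, then so is its set of attaching points. -/
theorem geodConvex_att {K : Set V} (hK : G.GeodConvex K) (hKc : G.GeodConvex Kᶜ) :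
    G.GeodConvex (G.att K) := by
  intro x (hx : G.IsCopointAt K x) y (hy : G.IsCopointAt K y) z hz
  refine ⟨⟨hK, hKc hx.prop.2 hy.prop.2 hz⟩, ?_⟩
  rintro C ⟨hC, hzC⟩ hKC
  by_contra hCK
  -- A convex set strictly larger than `K` contains every attaching point of `K`.
  have key : ∀ u, G.IsCopointAt K u → u ∈ C := fun u hu => by
    by_contra huC
    exact hCK (hu.2 ⟨hC, huC⟩ hKC)
  exact hzC (hC (key x hx) (key y hy) hz)

/-- If all the sets `W_{ab}` are convex, then the complement of each copoint is convex. -/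
theorem IsCopointAt.geodConvex_compl (hb : G.IsBipartite) (hc : G.Connected)
    (hW : ∀ a b, G.Adj a b → G.GeodConvex (G.closerSet a b)) {K : Set V} {x : V}
    (hK : G.IsCopointAt K x) : G.GeodConvex Kᶜ := by
  classical
  rcases K.eq_empty_or_nonempty with rfl | hne
  · rw [Set.compl_empty]
    exact fun _ _ _ _ _ _ => trivial
  -- For `y` in `K` nearest to `x` and `z` the next vertex towards `x`, the set W_{yz} contains `K`
  -- and misses `x`, so maximality of `K` forces equality.
  · obtain ⟨y, hy, hmin⟩ : ∃ y ∈ K, ∀ w ∈ K, G.dist y x ≤ G.dist w x := by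
      have hex : ∃ n, ∃ y ∈ K, G.dist y x = n := ⟨_, _, hne.some_mem, rfl⟩
      obtain ⟨y, hy, hyn⟩ := Nat.find_spec hex
      exact ⟨y, hy, fun w hw => hyn ▸ Nat.find_min' hex ⟨w, hw, rfl⟩⟩
    have hyx : y ≠ x := by rintro rfl; exact hK.prop.2 hy
    obtain ⟨z, hyz, hz⟩ := hc.exists_adj_dist_succ hyx
    have hzK : z ∉ K := fun h => by have := hmin z h; omega
    have hx : x ∉ G.closerSet y z := by
      rw [mem_closerSet, dist_comm, G.dist_comm (u := x)]; omega
    have hsub := hb.subset_closerSet hc hyz hK.prop.1 hy hzK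
    have : K = G.closerSet y z := hsub.antisymm (hK.2 ⟨hW y z hyz, hx⟩ hsub)
    rw [this, hb.compl_closerSet hc hyz]
    exact hW z y hyz.symm

theorem attConvex_of_geodConvex_closerSet (hb : G.IsBipartite) (hc : G.Connected)
    (hW : ∀ a b, G.Adj a b → G.GeodConvex (G.closerSet a b)) : G.AttConvex := by
  rintro K ⟨x, hK⟩
  exact geodConvex_att hK.prop.1 (hK.geodConvex_compl hb hc hW)

end Basic

end SimpleGraph

namespace SimpleGraph

/-! ### Distance in the hypercube. -/

section Hypercube

open scoped symmDiff

variable {ι : Type*} [DecidableEq ι]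

theorem hypercube_adj_iff {s t : Finset ι} : (hypercube ι).Adj s t ↔ (s ∆ t).card = 1 := by
  rw [Finset.card_eq_one]
  simp only [hypercube, ExistsUnique, Finset.ext_iff, Finset.mem_symmDiff, Finset.mem_singleton]
  constructor
  · rintro ⟨i, hi, hu⟩
    refine ⟨i, fun j => ⟨fun h => hu j (by tauto), ?_⟩⟩
    rintro rfl
    tauto
  · rintro ⟨i, hi⟩
    refine ⟨i, ?_, fun j hj => (hi j).1 (by tauto)⟩
    have := (hi i).2 rfl
    tauto

theorem card_symmDiff_le_length {s t : Finset ι} (p : (hypercube ι).Walk s t) :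
    (s ∆ t).card ≤ p.length := by
  induction p with
  | nil => simp
  | @cons u v w h p ih =>
    rw [Walk.length_cons]
    have h1 : (u ∆ w).card ≤ ((u ∆ v) ∪ (v ∆ w)).card :=
      Finset.card_le_card (symmDiff_triangle u v w)
    have h2 := Finset.card_union_le (u ∆ v) (v ∆ w)
    rw [hypercube_adj_iff.1 h] at h2
    omega

theorem exists_walk_hypercube (s t : Finset ι) :
    ∃ p : (hypercube ι).Walk s t, p.length = (s ∆ t).card := by
  induction hn : (s ∆ t).card generalizing s with
  | zero =>
    rw [Finset.card_eq_zero] at hn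
    obtain rfl : s = t := symmDiff_eq_bot.1 hn
    exact ⟨Walk.nil, rfl⟩
  | succ n ih =>
    obtain ⟨i, hi⟩ : (s ∆ t).Nonempty := Finset.card_pos.1 (by omega)
    have h1 : s ∆ (s ∆ {i}) = {i} := symmDiff_symmDiff_cancel_left s {i}
    have h2 : (s ∆ {i}) ∆ t = (s ∆ t).erase i := by
      ext j
      simp only [Finset.mem_symmDiff, Finset.mem_singleton, Finset.mem_erase] at hi ⊢
      by_cases hji : j = i
      · subst hji; tauto
      · tauto
    obtain ⟨p, hp⟩ := ih (s ∆ {i}) (by rw [h2, Finset.card_erase_of_mem hi, hn]; rfl)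
    exact ⟨Walk.cons (hypercube_adj_iff.2 (by rw [h1, Finset.card_singleton])) p,
      by rw [Walk.length_cons, hp]⟩

theorem hypercube_connected : (hypercube ι).Connected :=
  ⟨fun s t => ⟨(exists_walk_hypercube s t).choose⟩⟩

theorem dist_hypercube (s t : Finset ι) : (hypercube ι).dist s t = (s ∆ t).card := by
  obtain ⟨p, hp⟩ := exists_walk_hypercube s t
  obtain ⟨q, hq⟩ := hypercube_connected.exists_walk_length_eq_dist s t
  have := dist_le p
  have := card_symmDiff_le_length q
  omega

end Hypercube

/-! ### Partial cubes as isometric maps to finite sets; convexity of W_{ab}. -/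

section PartialCube

open scoped symmDiff

open scoped Classical in
theorem IsPartialCube.exists_dist_eq.{u} {V : Type u} {G : SimpleGraph V}
    (h : G.IsPartialCube) :
    ∃ (ι : Type u) (f : V → Finset ι), ∀ x y, G.dist x y = (f x ∆ f y).card := by
  obtain ⟨ι, H, hH, ⟨e⟩⟩ := h
  refine ⟨ι, fun x => (e x : Finset ι), fun x y => ?_⟩
  rw [← dist_hypercube, ← hH.2]
  have hpre := hH.1.coe.preconnected
  have hG : G.Preconnected := fun a b => by
    obtain ⟨p⟩ := hpre (e a) (e b)
    have := (p.map e.symm.toHom).reachable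
    simpa using this
  refine le_antisymm ?_ ?_
  · obtain ⟨p, hp⟩ := (hpre (e x) (e y)).exists_walk_length_eq_dist
    have := dist_le ((p.map e.symm.toHom).copy (e.symm_apply_apply x) (e.symm_apply_apply y))
    simpa [hp] using this
  · obtain ⟨p, hp⟩ := (hG x y).exists_walk_length_eq_dist
    have := dist_le (p.map e.toHom)
    rw [Walk.length_map, hp] at this
    exact this

theorem isPartialCube_of_dist_eq.{u} {V ι : Type u} [DecidableEq ι] {G : SimpleGraph V} (hc : G.Connected)
    (f : V → Finset ι) (hf : ∀ x y, G.dist x y = (f x ∆ f y).card) : G.IsPartialCube := by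
  have hinj : Function.Injective f := fun x y hxy => by
    rw [← hc.dist_eq_zero_iff, hf, hxy, symmDiff_self]; rfl
  let H : (hypercube ι).Subgraph := (⊤ : (hypercube ι).Subgraph).induce (Set.range f)
  have hadj : ∀ x y, (hypercube ι).Adj (f x) (f y) ↔ G.Adj x y := fun x y => by
    rw [hypercube_adj_iff, ← hf, dist_eq_one_iff_adj]
  let e : G ≃g H.coe :=
    { toEquiv := Equiv.ofInjective f hinj
      map_rel_iff' := by
        intro x y
        rw [← hadj]
        change H.Adj (f x) (f y) ↔ _
        simp [H] }
  have hHc : H.coe.Connected := e.connected_iff.1 hc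
  refine ⟨ι, H, ⟨(Subgraph.connected_iff' ).2 hHc, ?_⟩, ⟨e⟩⟩
  rintro ⟨_, x, rfl⟩ ⟨_, y, rfl⟩
  rw [dist_hypercube, ← hf]
  refine le_antisymm ?_ ?_
  · obtain ⟨p, hp⟩ := hc.exists_walk_length_eq_dist x y
    have := dist_le (p.map e.toHom)
    rw [Walk.length_map, hp] at this
    exact this
  · obtain ⟨p, hp⟩ := hHc.exists_walk_length_eq_dist (e x) (e y)
    have := dist_le ((p.map e.symm.toHom).copy (e.symm_apply_apply x) (e.symm_apply_apply y))
    rw [Walk.length_copy, Walk.length_map, hp] at this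
    exact this

/-- In a graph isometrically embedded in a hypercube the sets `W_{ab}` are convex. -/
theorem geodConvex_closerSet_of_dist_eq {V ι : Type*} [DecidableEq ι] {G : SimpleGraph V} (hc : G.Connected)
    (f : V → Finset ι) (hf : ∀ x y, G.dist x y = (f x ∆ f y).card) {a b : V} (h : G.Adj a b) :
    G.GeodConvex (G.closerSet a b) := by
  have h1 := dist_eq_one_iff_adj.2 h
  rw [hf, Finset.card_eq_one] at h1
  obtain ⟨i, hi⟩ := h1
  -- The labels of `a` and `b` differ only in `i`, so this coordinate alone decides which of them is
  -- nearer.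
  have hmem : ∀ x, x ∈ G.closerSet a b ↔ (i ∈ f x ↔ i ∈ f a) := by
    intro x
    have hb : f b = f a ∆ {i} := by rw [← hi, symmDiff_symmDiff_cancel_left]
    rw [mem_closerSet, hf, hf, hb, ← symmDiff_assoc]
    by_cases hx : i ∈ f x ∆ f a
    · have : (f x ∆ f a) ∆ {i} = (f x ∆ f a).erase i := by
        ext j
        simp only [Finset.mem_symmDiff, Finset.mem_singleton, Finset.mem_erase] at hx ⊢
        by_cases hj : j = i
        · subst hj; tauto
        · tauto
      rw [this, Finset.card_erase_of_mem hx]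
      rw [Finset.mem_symmDiff] at hx
      constructor
      · intro; omega
      · tauto
    · have : (f x ∆ f a) ∆ {i} = insert i (f x ∆ f a) := by
        ext j
        simp only [Finset.mem_symmDiff, Finset.mem_singleton, Finset.mem_insert] at hx ⊢
        by_cases hj : j = i
        · subst hj; tauto
        · tauto
      rw [this, Finset.card_insert_of_notMem hx]
      rw [Finset.mem_symmDiff] at hx
      constructor
      · tauto
      · intro; omega
  intro x hx y hy z hz
  rw [hmem] at hx hy ⊢
  rw [hc.mem_geodInterval_iff, hf, hf, hf] at hz
  by_contra hzi
  -- The coordinate `i` would be switched on the way to `z` and switched back afterwards, making the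
  -- triangle inequality strict.
  have hsub : f x ∆ f y ⊆ ((f x ∆ f z).erase i) ∪ (f z ∆ f y) := by
    intro j hj
    simp only [Finset.mem_symmDiff, Finset.mem_union, Finset.mem_erase] at hj ⊢
    by_cases hji : j = i
    · subst hji; tauto
    · tauto
  have h2 := (Finset.card_le_card hsub).trans (Finset.card_union_le _ _)
  have hxz : i ∈ f x ∆ f z := by rw [Finset.mem_symmDiff]; tauto
  rw [Finset.card_erase_of_mem hxz] at h2
  have := Finset.card_pos.2 ⟨i, hxz⟩
  omega

end PartialCube

/-! ### Embedding into a hypercube when all W_{ab} are convex. -/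

section Embedding

open scoped symmDiff

variable {V : Type*} {G : SimpleGraph V}

/-- The sets `W_{ab}` that contain `x` but not the base vertex `o`. -/
def closerSetsAt (G : SimpleGraph V) (o x : V) : Set (Set V) :=
  {W | (∃ a b, G.Adj a b ∧ W = G.closerSet a b) ∧ o ∉ W ∧ x ∈ W}

/-- If the sets `W_{ab}` are convex, one that separates the ends of an edge is determined by it. -/
theorem closerSet_eq_of_separates (hb : G.IsBipartite) (hc : G.Connected)
    (hW : ∀ a b, G.Adj a b → G.GeodConvex (G.closerSet a b)) {a b u v : V} (hab : G.Adj a b)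
    (huv : G.Adj u v) (hu : u ∈ G.closerSet a b) (hv : v ∉ G.closerSet a b) :
    G.closerSet a b = G.closerSet u v := by
  refine (hb.subset_closerSet hc huv (hW a b hab) hu hv).antisymm ?_
  rw [hb.notMem_closerSet hc hab] at hv
  have hu' : u ∉ G.closerSet b a := (hb.notMem_closerSet hc hab.symm).2 hu
  have := hb.subset_closerSet hc huv.symm (hW b a hab.symm) hv hu'
  rw [← hb.compl_closerSet hc hab, ← hb.compl_closerSet hc huv] at this
  exact Set.compl_subset_compl.1 this

/-- Along an edge `uv` the family `closerSetsAt` changes by exactly one of `W_{uv}` and `W_{vu}`. -/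
theorem exists_closerSetsAt_iff (hb : G.IsBipartite) (hc : G.Connected)
    (hW : ∀ a b, G.Adj a b → G.GeodConvex (G.closerSet a b)) (o : V) {u v : V} (huv : G.Adj u v) :
    ∃ W, (W = G.closerSet u v ∨ W = G.closerSet v u) ∧
      ∀ X, ¬(X ∈ G.closerSetsAt o u ↔ X ∈ G.closerSetsAt o v) ↔ X = W := by
  have main : ∀ u v : V, G.Adj u v → o ∈ G.closerSet u v →
      ∀ X, ¬(X ∈ G.closerSetsAt o u ↔ X ∈ G.closerSetsAt o v) ↔ X = G.closerSet v u := by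
    intro u v huv ho X
    have ho' : o ∉ G.closerSet v u := (hb.notMem_closerSet hc huv.symm).2 ho
    constructor
    · intro hX
      by_cases hu : u ∈ X
      · have hXu : X ∈ G.closerSetsAt o u := by
          by_contra h1
          have h2 : X ∈ G.closerSetsAt o v := by tauto
          exact h1 ⟨h2.1, h2.2.1, hu⟩
        obtain ⟨⟨a, b, hab, rfl⟩, hoX, -⟩ := hXu
        have hv : v ∉ G.closerSet a b := fun hv =>
          hX ⟨fun h => ⟨h.1, h.2.1, hv⟩, fun h => ⟨h.1, h.2.1, hu⟩⟩
        rw [closerSet_eq_of_separates hb hc hW hab huv hu hv] at hoX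
        exact absurd ho hoX
      · have hXv : X ∈ G.closerSetsAt o v := by
          by_contra h1
          have h2 : X ∈ G.closerSetsAt o u := by tauto
          exact hu h2.2.2
        obtain ⟨⟨a, b, hab, rfl⟩, hoX, hv⟩ := hXv
        exact closerSet_eq_of_separates hb hc hW hab huv.symm hv hu
    · rintro rfl h
      exact right_notMem_closerSet (h.2 ⟨⟨v, u, huv.symm, rfl⟩, ho', left_mem_closerSet huv.symm⟩).2.2
  by_cases ho : o ∈ G.closerSet u v
  · exact ⟨G.closerSet v u, Or.inr rfl, main u v huv ho⟩
  · refine ⟨G.closerSet u v, Or.inl rfl, fun X => ?_⟩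
    rw [← main v u huv.symm ((hb.notMem_closerSet hc huv).1 ho) X]
    tauto

/-- Vertices of the hypercube are finite sets. The family is empty at `o` and changes by one set per
edge of a walk to `o`. -/
theorem finite_closerSetsAt (hb : G.IsBipartite) (hc : G.Connected)
    (hW : ∀ a b, G.Adj a b → G.GeodConvex (G.closerSet a b)) (o x : V) :
    (G.closerSetsAt o x).Finite := by
  obtain ⟨p⟩ := hc.preconnected x o
  induction p with
  | nil =>
    convert Set.finite_empty
    rw [Set.eq_empty_iff_forall_notMem]
    exact fun X hX => hX.2.1 hX.2.2
  | cons h p ih =>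
    obtain ⟨W, -, hX⟩ := exists_closerSetsAt_iff hb hc hW _ h
    refine (ih.insert W).subset fun X hXm => ?_
    by_cases hXW : X = W
    · exact Or.inl hXW
    · have := mt (hX X).1 hXW
      exact Or.inr (by tauto)

open scoped Classical in
theorem isPartialCube_of_geodConvex_closerSet (hb : G.IsBipartite) (hc : G.Connected)
    (hW : ∀ a b, G.Adj a b → G.GeodConvex (G.closerSet a b)) : G.IsPartialCube := by
  obtain ⟨o⟩ := hc.nonempty
  let f : V → Finset (Set V) := fun x => (finite_closerSetsAt hb hc hW o x).toFinset
  refine isPartialCube_of_dist_eq hc f fun x y => ?_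
  induction hn : G.dist y x generalizing y with
  | zero =>
    obtain rfl := hc.dist_eq_zero_iff.1 hn
    rw [dist_self, symmDiff_self]
    rfl
  | succ n ih =>
    have hne : y ≠ x := by rintro rfl; simp at hn
    obtain ⟨z, hyz, hz⟩ := hc.exists_adj_dist_succ hne
    obtain ⟨W, hWz, hX⟩ := exists_closerSetsAt_iff hb hc hW o hyz
    have hxz : x ∈ G.closerSet z y := by
      rw [mem_closerSet, dist_comm, G.dist_comm (u := x)]; omega
    have hxy : x ∉ G.closerSet y z := (hb.notMem_closerSet hc hyz).2 hxz
    have hmem : ∀ X v, X ∈ f v ↔ X ∈ G.closerSetsAt o v := fun X v => Set.Finite.mem_toFinset _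
    -- The set that changes along `yz` does not separate `z` from `x`, because `z` is nearer to `x`
    -- than `y` is. Hence it adds a new element to the symmetric difference.
    have hsep : W ∈ f x ↔ W ∈ f z := by
      rw [hmem, hmem]
      have hWxz : x ∈ W ↔ z ∈ W := by
        rcases hWz with rfl | rfl
        · exact iff_of_false hxy right_notMem_closerSet
        · exact iff_of_true hxz (left_mem_closerSet hyz.symm)
      exact ⟨fun h => ⟨h.1, h.2.1, hWxz.1 h.2.2⟩, fun h => ⟨h.1, h.2.1, hWxz.2 h.2.2⟩⟩
    have hins : f x ∆ f y = insert W (f x ∆ f z) := by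
      ext X
      have hXW := hX X
      rw [← hmem, ← hmem] at hXW
      rw [Finset.mem_insert, Finset.mem_symmDiff, Finset.mem_symmDiff]
      by_cases h : X = W
      · subst h; tauto
      · tauto
    have hnot : W ∉ f x ∆ f z := by rw [Finset.mem_symmDiff]; tauto
    rw [hins, Finset.card_insert_of_notMem hnot, ← ih z (by omega), dist_comm,
      G.dist_comm (u := x)]
    omega

end Embedding

end SimpleGraph

/-! ### Counting changes of a truth value along a closed sequence. -/

section Counting

open scoped Classical in
/-- The number of indices `i < n` at which the truth value of `s` changes. -/
noncomputable def changeCount (s : ℕ → Prop) (n : ℕ) : ℕ :=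
  ((Finset.range n).filter fun i => ¬(s i ↔ s (i + 1))).card

theorem even_changeCount_iff (s : ℕ → Prop) (n : ℕ) : Even (changeCount s n) ↔ (s 0 ↔ s n) := by
  classical
  induction n with
  | zero => simp [changeCount]
  | succ n ih =>
    unfold changeCount at ih ⊢
    rw [Finset.range_add_one, Finset.filter_insert]
    split_ifs with h
    · rw [ih]
      tauto
    · rw [Finset.card_insert_of_notMem (by simp), Nat.even_add_one, ih]
      tauto

open scoped Classical in
/-- If the truth value of `s` never changes and changes back between `l` and `m`, then it changes
at most once there. -/
theorem card_changes_le_one (s : ℕ → Prop) (l m : ℕ)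
    (h : ∀ i j k, l ≤ i → i ≤ j → j ≤ k → k ≤ m → (s i ↔ s k) → (s j ↔ s i)) :
    ((Finset.Ico l m).filter fun i => ¬(s i ↔ s (i + 1))).card ≤ 1 := by
  have key : ∀ i j, l ≤ i → i < j → j < m → ¬(s i ↔ s (i + 1)) → (s j ↔ s (j + 1)) := by
    intro i j hi hij hj h1
    by_contra h2
    have h3 := h i (i + 1) j hi (by omega) (by omega) (by omega)
    have h4 := h i (i + 1) (j + 1) hi (by omega) (by omega) (by omega)
    tauto
  refine Finset.card_le_one.2 fun i hi j hj => ?_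
  simp only [Finset.mem_filter, Finset.mem_Ico] at hi hj
  rcases lt_trichotomy i j with hij | hij | hij
  · exact absurd (key i j hi.1.1 hij hj.1.2 hi.2) hj.2
  · exact hij
  · exact absurd (key j i hj.1.1 hij hi.1.2 hj.2) hi.2

/-- Three monotone pieces allow at most three changes; closedness makes the number even, and
non-constancy makes it positive. -/
theorem changeCount_eq_two (s : ℕ → Prop) {k l n : ℕ}
    (hclosed : s 0 ↔ s n)
    (h1 : ∀ i j m, i ≤ j → j ≤ m → m ≤ k → (s i ↔ s m) → (s j ↔ s i))
    (h2 : ∀ i j m, k ≤ i → i ≤ j → j ≤ m → m ≤ l → (s i ↔ s m) → (s j ↔ s i))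
    (h3 : ∀ i j m, l ≤ i → i ≤ j → j ≤ m → m ≤ n → (s i ↔ s m) → (s j ↔ s i))
    (hne : ∃ i ≤ n, ∃ j ≤ n, s i ∧ ¬ s j) : changeCount s n = 2 := by
  classical
  have hle : changeCount s n ≤ 3 := by
    have hsub : ((Finset.range n).filter fun i => ¬(s i ↔ s (i + 1))) ⊆
        (((Finset.Ico 0 k).filter fun i => ¬(s i ↔ s (i + 1))) ∪
        ((Finset.Ico k l).filter fun i => ¬(s i ↔ s (i + 1)))) ∪
        ((Finset.Ico l n).filter fun i => ¬(s i ↔ s (i + 1))) := by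
      intro i hi
      simp only [Finset.mem_filter, Finset.mem_union, Finset.mem_range, Finset.mem_Ico] at hi ⊢
      have : i < k ∨ (k ≤ i ∧ i < l) ∨ (l ≤ i ∧ i < n) := by omega
      have h0 : 0 ≤ i := Nat.zero_le i
      tauto
    have c1 := card_changes_le_one s 0 k fun i j m _ => h1 i j m
    have c2 := card_changes_le_one s k l h2
    have c3 := card_changes_le_one s l n h3
    have := Finset.card_le_card hsub
    have := Finset.card_union_le (((Finset.Ico 0 k).filter fun i => ¬(s i ↔ s (i + 1))) ∪
        ((Finset.Ico k l).filter fun i => ¬(s i ↔ s (i + 1))))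
        ((Finset.Ico l n).filter fun i => ¬(s i ↔ s (i + 1)))
    have := Finset.card_union_le ((Finset.Ico 0 k).filter fun i => ¬(s i ↔ s (i + 1)))
        ((Finset.Ico k l).filter fun i => ¬(s i ↔ s (i + 1)))
    unfold changeCount
    omega
  have hpos : changeCount s n ≠ 0 := by
    intro h0
    have hconst : ∀ i ≤ n, (s i ↔ s 0) := by
      intro i
      induction i with
      | zero => exact fun _ => Iff.rfl
      | succ i ih =>
        intro hi
        have h4 : ¬¬(s i ↔ s (i + 1)) :=
          (Finset.filter_eq_empty_iff.1 (Finset.card_eq_zero.1 h0)) (Finset.mem_range.2 hi)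
        have := ih (by omega)
        tauto
    obtain ⟨i, hi, j, hj, hsi, hsj⟩ := hne
    exact hsj ((hconst j hj).2 ((hconst i hi).1 hsi))
  have heven := (even_changeCount_iff s n).2 hclosed
  interval_cases changeCount s n
  · exact absurd rfl hpos
  · exact absurd heven (by decide)
  · rfl
  · exact absurd heven (by decide)

theorem card_filter_eq_add {α : Type*} (s : Finset α) (P Q R : α → Prop) [DecidablePred P]
    [DecidablePred Q] [DecidablePred R]
    (h : ∀ i ∈ s, (P i ↔ Q i ∨ R i)) (hd : ∀ i ∈ s, ¬(Q i ∧ R i)) :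
    (s.filter P).card = (s.filter Q).card + (s.filter R).card := by
  classical
  rw [← Finset.card_union_of_disjoint, ← Finset.filter_or]
  · rw [Finset.filter_congr h]
  · rw [Finset.disjoint_filter]
    exact fun i hi h1 h2 => hd i hi ⟨h1, h2⟩

end Counting

namespace SimpleGraph

variable {V : Type*} {G : SimpleGraph V}

/-- The perimeter of a triple of vertices. -/
noncomputable def perimeter (G : SimpleGraph V) (x y z : V) : ℕ :=
  G.dist x y + G.dist x z + G.dist y z

/-- The sets `W_{gh}` contain the intervals between those of their elements that span with `g` a
triple of perimeter at most `r`. -/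
def ClosersConvexUpTo (G : SimpleGraph V) (r : ℕ) : Prop :=
  ∀ g h, G.Adj g h → ∀ x ∈ G.closerSet g h, ∀ y ∈ G.closerSet g h,
    G.perimeter g x y ≤ r → G.geodInterval x y ⊆ G.closerSet g h

/-- A closed walk `c 0, …, c n` which consists of three geodesics. -/
structure IsGeodesicTriangle (G : SimpleGraph V) (c : ℕ → V) (k l n : ℕ) : Prop where
  adj : ∀ i < n, G.Adj (c i) (c (i + 1))
  closed : c n = c 0
  le₁ : k ≤ l
  le₂ : l ≤ n
  dist₁ : G.dist (c 0) (c k) = k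
  dist₂ : G.dist (c k) (c l) = l - k
  dist₃ : G.dist (c l) (c n) = n - l

/-- The vertices of a closed walk. -/
def walkVerts (c : ℕ → V) (n : ℕ) : Set V := {x | ∃ i ≤ n, c i = x}

/-! ### Closed walks made of three geodesics. -/

section Triangle

variable {c : ℕ → V} {k l n : ℕ}

theorem IsGeodesicTriangle.dist_le_sub (hc : G.Connected) (hT : G.IsGeodesicTriangle c k l n)
    {i j : ℕ} (hij : i ≤ j) (hj : j ≤ n) : G.dist (c i) (c j) ≤ j - i := by
  induction j, hij using Nat.le_induction with
  | base => simp
  | succ j hij ih =>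
    have h1 := ih (by omega)
    have h2 := hc.dist_triangle (u := c i) (v := c j) (w := c (j + 1))
    rw [dist_eq_one_iff_adj.2 (hT.adj j (by omega))] at h2
    omega

theorem IsGeodesicTriangle.dist_le_sub' (hc : G.Connected) (hT : G.IsGeodesicTriangle c k l n)
    {i j : ℕ} (hij : i ≤ j) (hj : j ≤ n) : G.dist (c i) (c j) ≤ n - (j - i) := by
  have h1 := hT.dist_le_sub hc (Nat.zero_le i) (hij.trans hj)
  have h2 := hT.dist_le_sub hc hj le_rfl
  have h3 := hc.dist_triangle (u := c i) (v := c 0) (w := c j)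
  rw [hT.closed, dist_comm] at h2
  rw [dist_comm] at h1
  omega

/-- Both arcs of the closed walk bound each distance, and three points cut the walk into arcs of
total length `n`. -/
theorem IsGeodesicTriangle.perimeter_le (hc : G.Connected) (hT : G.IsGeodesicTriangle c k l n)
    {x y z : V} (hx : x ∈ walkVerts c n) (hy : y ∈ walkVerts c n) (hz : z ∈ walkVerts c n) :
    G.perimeter x y z ≤ n := by
  obtain ⟨i, hi, rfl⟩ := hx
  obtain ⟨j, hj, rfl⟩ := hy
  obtain ⟨m, hm, rfl⟩ := hz
  have key : ∀ i j, i ≤ n → j ≤ n → (i ≤ j → G.dist (c i) (c j) ≤ j - i ∧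
      G.dist (c i) (c j) ≤ n - (j - i)) ∧ (j ≤ i → G.dist (c i) (c j) ≤ i - j ∧
      G.dist (c i) (c j) ≤ n - (i - j)) := fun i j hi hj =>
    ⟨fun h => ⟨hT.dist_le_sub hc h hj, hT.dist_le_sub' hc h hj⟩, fun h => by
      rw [dist_comm]; exact ⟨hT.dist_le_sub hc h hi, hT.dist_le_sub' hc h hi⟩⟩
  have h1 := key i j hi hj
  have h2 := key i m hi hm
  have h3 := key j m hj hm
  unfold perimeter
  rcases le_total i j with a1 | a1 <;> rcases le_total i m with a2 | a2 <;>
    rcases le_total j m with a3 | a3 <;> simp only [a1, a2, a3, forall_const] at h1 h2 h3 <;>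
    omega

theorem IsGeodesicTriangle.mem_geodInterval (hc : G.Connected) (hT : G.IsGeodesicTriangle c k l n)
    {a b : ℕ} (hab : a ≤ b) (hb : b ≤ n) (hd : G.dist (c a) (c b) = b - a) {i j m : ℕ}
    (hi : a ≤ i) (hij : i ≤ j) (hjm : j ≤ m) (hm : m ≤ b) :
    c j ∈ G.geodInterval (c i) (c m) := by
  rw [hc.mem_geodInterval_iff]
  have h1 := hT.dist_le_sub hc hi (by omega)
  have h2 := hT.dist_le_sub hc hij (by omega)
  have h3 := hT.dist_le_sub hc hjm (by omega)
  have h4 := hT.dist_le_sub hc hm (by omega)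
  have h5 := hc.dist_triangle (u := c i) (v := c j) (w := c m)
  have h6 := hc.dist_triangle (u := c a) (v := c i) (w := c b)
  have h7 := hc.dist_triangle (u := c i) (v := c m) (w := c b)
  omega

theorem Connected.exists_isGeodesicTriangle (hc : G.Connected) (p q t : V) :
    ∃ c k l, G.IsGeodesicTriangle c k l (G.perimeter p q t) ∧ c 0 = p ∧ c k = q ∧ c l = t := by
  obtain ⟨P, hP⟩ := hc.exists_walk_length_eq_dist p q
  obtain ⟨Q, hQ⟩ := hc.exists_walk_length_eq_dist q t
  obtain ⟨R, hR⟩ := hc.exists_walk_length_eq_dist t p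
  have hl : (P.append (Q.append R)).length = G.perimeter p q t := by
    rw [Walk.length_append, Walk.length_append, hP, hQ, hR, perimeter, G.dist_comm (u := t)]
    omega
  have h0 : (P.append (Q.append R)).getVert 0 = p := Walk.getVert_zero _
  have h1 : (P.append (Q.append R)).getVert (G.dist p q) = q := by
    rw [Walk.getVert_append, hP, if_neg (lt_irrefl _), Nat.sub_self, Walk.getVert_zero]
  have h2 : (P.append (Q.append R)).getVert (G.dist p q + G.dist q t) = t := by
    rw [Walk.getVert_append, hP, if_neg (by omega), Nat.add_sub_cancel_left, Walk.getVert_append,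
      hQ, if_neg (lt_irrefl _), Nat.sub_self, Walk.getVert_zero]
  have h3 : (P.append (Q.append R)).getVert (G.perimeter p q t) = p := by
    rw [← hl, Walk.getVert_length]
  have hper : G.perimeter p q t = G.dist p q + G.dist q t + G.dist t p := by
    rw [perimeter, G.dist_comm (u := t)]; omega
  refine ⟨(P.append (Q.append R)).getVert, G.dist p q, G.dist p q + G.dist q t,
    ⟨fun i hi => Walk.adj_getVert_succ _ (hl ▸ hi), h3.trans h0.symm, by omega, by omega, ?_, ?_, ?_⟩,
    h0, h1, h2⟩
  · rw [h0, h1]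
  · rw [h1, h2]; omega
  · rw [h2, h3]; omega

end Triangle

/-! ### Separating edges and the Crofton formula. -/

section Separation

/-- Separation of edges is symmetric: with the next lemma, `gh` separates `z` from `w` exactly when
`zw` separates `g` from `h`. Both compare the four distances between the ends, where bipartiteness
leaves only steps of ±1. -/
theorem IsBipartite.mem_closerSet_iff_of_adj (hb : G.IsBipartite) (hc : G.Connected)
    {z w g h : V} (hzw : G.Adj z w) (hgh : G.Adj g h)
    (hs : g ∈ G.closerSet z w ↔ h ∈ G.closerSet z w) :
    z ∈ G.closerSet g h ↔ w ∈ G.closerSet g h := by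
  simp only [mem_closerSet] at hs ⊢
  have h1 := hb.dist_adj_cases hc hzw g
  have h2 := hb.dist_adj_cases hc hzw h
  have h3 := hb.dist_adj_cases hc hgh z
  have h4 := hb.dist_adj_cases hc hgh w
  simp only [G.dist_comm (u := g) (v := z), G.dist_comm (u := g) (v := w),
    G.dist_comm (u := h) (v := z), G.dist_comm (u := h) (v := w)] at *
  omega

theorem IsBipartite.mem_closerSet_of_crossing (hb : G.IsBipartite) (hc : G.Connected)
    {z w g h : V} (hzw : G.Adj z w) (hgh : G.Adj g h)
    (hg : g ∈ G.closerSet z w) (hh : h ∉ G.closerSet z w) :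
    z ∈ G.closerSet g h ∧ w ∉ G.closerSet g h := by
  simp only [mem_closerSet] at hg hh ⊢
  have h1 := hb.dist_adj_cases hc hzw g
  have h2 := hb.dist_adj_cases hc hzw h
  have h3 := hb.dist_adj_cases hc hgh z
  have h4 := hb.dist_adj_cases hc hgh w
  simp only [G.dist_comm (u := g) (v := z), G.dist_comm (u := g) (v := w),
    G.dist_comm (u := h) (v := z), G.dist_comm (u := h) (v := w)] at *
  omega

variable {r : ℕ} {S : Set V} {z w : V}

/-- Both sides of an edge `zw` contain the intervals between their elements in `S`, if the triples
that `z` forms with elements of `S` have small perimeter. -/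
theorem ClosersConvexUpTo.mem_iff (hb : G.IsBipartite) (hc : G.Connected)
    (hr : G.ClosersConvexUpTo r) (hzw : G.Adj z w)
    (hS : ∀ x ∈ S, ∀ y ∈ S, G.perimeter z x y ≤ r) {x y p : V} (hx : x ∈ S) (hy : y ∈ S)
    (hxy : x ∈ G.closerSet z w ↔ y ∈ G.closerSet z w) (hp : p ∈ G.geodInterval x y) :
    p ∈ G.closerSet z w ↔ x ∈ G.closerSet z w := by
  by_cases hxW : x ∈ G.closerSet z w
  · exact iff_of_true (hr z w hzw x hxW y (hxy.1 hxW) (hS x hx y hy) hp) hxW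
  · have hyW := mt hxy.2 hxW
    refine iff_of_false ?_ hxW
    rw [hb.notMem_closerSet hc hzw] at hxW hyW ⊢
    -- Both `x` and `y` are nearer to `w`, so replacing `z` by `w` lowers the perimeter by 2.
    refine hr w z hzw.symm x hxW y hyW ?_ hp
    have h1 := hS x hx y hy
    have h2 := hb.dist_eq_of_mem_closerSet hc hzw.symm hxW
    have h3 := hb.dist_eq_of_mem_closerSet hc hzw.symm hyW
    simp only [perimeter, G.dist_comm (u := z), G.dist_comm (u := w)] at h1 ⊢
    omega

/-- If `t` disagreed, one end of `gh` would lie between `t` and the other end, and the side of `zw`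
shared by these two would not be interval-closed. -/
theorem ClosersConvexUpTo.mem_closerSet_iff (hb : G.IsBipartite) (hc : G.Connected)
    (hr : G.ClosersConvexUpTo r) (hzw : G.Adj z w)
    (hS : ∀ x ∈ S, ∀ y ∈ S, G.perimeter z x y ≤ r) {g h t : V} (hg : g ∈ S) (hh : h ∈ S)
    (ht : t ∈ S) (hgh : G.Adj g h) (hgW : g ∈ G.closerSet z w) (hhW : h ∉ G.closerSet z w) :
    t ∈ G.closerSet z w ↔ t ∈ G.closerSet g h := by
  constructor
  · intro htW
    by_contra hn
    have h1 := hb.dist_eq_of_mem_closerSet hc hgh.symm ((hb.notMem_closerSet hc hgh).1 hn)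
    exact hhW ((hr.mem_iff hb hc hzw hS ht hg (iff_of_true htW hgW) (hc.mem_geodInterval_iff.2
      (by rw [h1, dist_eq_one_iff_adj.2 hgh.symm]))).2 htW)
  · intro htg
    by_contra hn
    have h1 := hb.dist_eq_of_mem_closerSet hc hgh htg
    exact hn ((hr.mem_iff hb hc hzw hS ht hh (iff_of_false hn hhW) (hc.mem_geodInterval_iff.2
      (by rw [h1, dist_eq_one_iff_adj.2 hgh]))).1 hgW)

open scoped Classical in
/-- The number of edges `c i, c (i + 1)` that separate `u` from `v`. -/
noncomputable def sepCount (G : SimpleGraph V) (c : ℕ → V) (n : ℕ) (u v : V) : ℕ :=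
  ((Finset.range n).filter fun i =>
    ¬(u ∈ G.closerSet (c i) (c (i + 1)) ↔ v ∈ G.closerSet (c i) (c (i + 1)))).card

variable {c : ℕ → V} {k l n : ℕ}

theorem sepCount_self (u : V) : G.sepCount c n u u = 0 := by
  simp [sepCount]

theorem sepCount_comm (u v : V) : G.sepCount c n u v = G.sepCount c n v u := by
  unfold sepCount
  congr 1
  ext i
  simp only [Finset.mem_filter]
  tauto

theorem sepCount_add_le (u v w : V) :
    G.sepCount c n u v + G.sepCount c n u w + G.sepCount c n v w ≤ 2 * n := by
  classical
  unfold sepCount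
  rw [Finset.card_filter, Finset.card_filter, Finset.card_filter, ← Finset.sum_add_distrib,
    ← Finset.sum_add_distrib]
  refine (Finset.sum_le_card_nsmul _ _ 2 fun i _ => ?_).trans ?_
  · by_cases h1 : u ∈ G.closerSet (c i) (c (i + 1)) <;>
      by_cases h2 : v ∈ G.closerSet (c i) (c (i + 1)) <;>
      by_cases h3 : w ∈ G.closerSet (c i) (c (i + 1)) <;> simp [h1, h2, h3]
  · rw [Finset.card_range, smul_eq_mul, mul_comm]

theorem perimeter_le_of_two_mul_dist_eq {u v w : V} (h1 : 2 * G.dist u v = G.sepCount c n u v)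
    (h2 : 2 * G.dist u w = G.sepCount c n u w) (h3 : 2 * G.dist v w = G.sepCount c n v w) :
    G.perimeter u v w ≤ n := by
  have := G.sepCount_add_le (c := c) (n := n) u v w
  unfold perimeter
  omega

/-- For one edge of the walk, `A` says that `zw` does not separate its ends, `T` that `t` is on the
side of `z`, and `z`, `w`, `t` that these vertices are nearer to its first end. The crossing edges
are then exactly those gained in passing from `z` to `w`; in the next lemma they are lost. -/
theorem separates_iff_of_same {A T z w t : Prop} (h1 : A → (z ↔ w))
    (h2 : ¬A → ¬(z ↔ w) ∧ (T ↔ (t ↔ z))) (hT : T) :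
    (¬(w ↔ t) ↔ ¬(z ↔ t) ∨ ¬A) ∧ ¬(¬(z ↔ t) ∧ ¬A) := by
  grind

theorem separates_iff_of_not_same {A T z w t : Prop} (h1 : A → (z ↔ w))
    (h2 : ¬A → ¬(z ↔ w) ∧ (T ↔ (t ↔ z))) (hT : ¬T) :
    (¬(z ↔ t) ↔ ¬(w ↔ t) ∨ ¬A) ∧ ¬(¬(w ↔ t) ∧ ¬A) := by
  grind

/-- The formula `2 * dist z t = sepCount z t` propagates along an edge `zw` with both sides meeting
the triangle. -/
theorem IsGeodesicTriangle.two_mul_dist_eq (hb : G.IsBipartite) (hc : G.Connected)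
    (hT : G.IsGeodesicTriangle c k l n) (hr : G.ClosersConvexUpTo r) (hzw : G.Adj z w)
    (hS : ∀ x ∈ S, ∀ y ∈ S, G.perimeter z x y ≤ r) (hcS : walkVerts c n ⊆ S)
    (hz : ∃ x ∈ walkVerts c n, x ∈ G.closerSet z w)
    (hw : ∃ x ∈ walkVerts c n, x ∉ G.closerSet z w) {t : V} (ht : t ∈ S)
    (h : 2 * G.dist z t = G.sepCount c n z t) : 2 * G.dist w t = G.sepCount c n w t := by
  classical
  have hmem : ∀ i ≤ n, c i ∈ S := fun i hi => hcS ⟨i, hi, rfl⟩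
  -- Each of the three geodesics crosses `zw` at most once, and the walk meets both sides, so there
  -- are exactly two crossings. Both affect the count for `t` in the same direction, matching a
  -- change of 1 in the distance.
  have hJ : changeCount (fun i => c i ∈ G.closerSet z w) n = 2 := by
    refine changeCount_eq_two (k := k) (l := l) _ (by rw [hT.closed]) ?_ ?_ ?_ ?_
    · intro i j m hij hjm hm hs
      have := hT.le₁
      have := hT.le₂
      exact hr.mem_iff hb hc hzw hS (hmem i (by omega)) (hmem m (by omega)) hs
        (hT.mem_geodInterval hc (Nat.zero_le k) (by omega) hT.dist₁ (Nat.zero_le i) hij hjm hm)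
    · intro i j m hi hij hjm hm hs
      have := hT.le₁
      have := hT.le₂
      exact hr.mem_iff hb hc hzw hS (hmem i (by omega)) (hmem m (by omega)) hs
        (hT.mem_geodInterval hc hT.le₁ (by omega) hT.dist₂ hi hij hjm hm)
    · intro i j m hi hij hjm hm hs
      have := hT.le₁
      have := hT.le₂
      exact hr.mem_iff hb hc hzw hS (hmem i (by omega)) (hmem m (by omega)) hs
        (hT.mem_geodInterval hc hT.le₂ le_rfl hT.dist₃ hi hij hjm hm)
    · obtain ⟨_, ⟨i, hi, rfl⟩, hiz⟩ := hz
      obtain ⟨_, ⟨j, hj, rfl⟩, hjw⟩ := hw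
      exact ⟨i, hi, j, hj, hiz, hjw⟩
  have hside : ∀ i < n, (c i ∈ G.closerSet z w ↔ c (i + 1) ∈ G.closerSet z w) →
      (z ∈ G.closerSet (c i) (c (i + 1)) ↔ w ∈ G.closerSet (c i) (c (i + 1))) := fun i hi =>
    hb.mem_closerSet_iff_of_adj hc hzw (hT.adj i hi)
  have hcross : ∀ i < n, ¬(c i ∈ G.closerSet z w ↔ c (i + 1) ∈ G.closerSet z w) →
      ¬(z ∈ G.closerSet (c i) (c (i + 1)) ↔ w ∈ G.closerSet (c i) (c (i + 1))) ∧
      ((t ∈ G.closerSet z w) ↔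
        (t ∈ G.closerSet (c i) (c (i + 1)) ↔ z ∈ G.closerSet (c i) (c (i + 1)))) := by
    intro i hi hne
    have hadj := hT.adj i hi
    by_cases hi1 : c i ∈ G.closerSet z w
    · have hi2 : c (i + 1) ∉ G.closerSet z w := by tauto
      have h1 := hb.mem_closerSet_of_crossing hc hzw hadj hi1 hi2
      have h2 := hr.mem_closerSet_iff hb hc hzw hS (hmem i (by omega)) (hmem (i + 1) (by omega))
        ht hadj hi1 hi2
      tauto
    · have hi2 : c (i + 1) ∈ G.closerSet z w := by tauto
      have h1 := hb.mem_closerSet_of_crossing hc hzw hadj.symm hi2 hi1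
      have h2 := hr.mem_closerSet_iff hb hc hzw hS (hmem (i + 1) (by omega)) (hmem i (by omega))
        ht hadj.symm hi2 hi1
      rw [← hb.notMem_closerSet hc hadj, ← hb.notMem_closerSet hc hadj] at h1
      rw [← hb.notMem_closerSet hc hadj] at h2
      tauto
  unfold changeCount at hJ
  by_cases htW : t ∈ G.closerSet z w
  · have hd := hb.dist_eq_of_mem_closerSet hc hzw htW
    have : G.sepCount c n w t = G.sepCount c n z t + 2 := by
      rw [← hJ]
      exact card_filter_eq_add _ _ _ _
        (fun i hi => (separates_iff_of_same (hside i (Finset.mem_range.1 hi))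
          (hcross i (Finset.mem_range.1 hi)) htW).1)
        fun i hi => (separates_iff_of_same (hside i (Finset.mem_range.1 hi))
          (hcross i (Finset.mem_range.1 hi)) htW).2
    rw [G.dist_comm (u := w), hd, this, ← h, G.dist_comm (u := z)]
    ring
  · have hd := hb.dist_eq_of_mem_closerSet hc hzw.symm ((hb.notMem_closerSet hc hzw).1 htW)
    have : G.sepCount c n z t = G.sepCount c n w t + 2 := by
      rw [← hJ]
      exact card_filter_eq_add _ _ _ _
        (fun i hi => (separates_iff_of_not_same (hside i (Finset.mem_range.1 hi))
          (hcross i (Finset.mem_range.1 hi)) htW).1)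
        fun i hi => (separates_iff_of_not_same (hside i (Finset.mem_range.1 hi))
          (hcross i (Finset.mem_range.1 hi)) htW).2
    rw [G.dist_comm (u := z), hd] at h
    rw [G.dist_comm (u := w)]
    omega

end Separation

end SimpleGraph

/-! ### Crofton sets and the convex set spanned by a geodesic triangle. -/

namespace SimpleGraph

variable {V : Type*} {G : SimpleGraph V} {c : ℕ → V} {k l n r : ℕ}

/-- A set containing the vertices of the closed walk `c`, on which twice the distance counts
the separating edges of `c`, and which is generated by the vertices of `c` by means of intervals
relative to the set. -/
structure IsCroftonSet (G : SimpleGraph V) (c : ℕ → V) (n : ℕ) (T : Set V) : Prop where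
  subset : walkVerts c n ⊆ T
  dist_eq : ∀ u ∈ T, ∀ v ∈ T, 2 * G.dist u v = G.sepCount c n u v
  generated : ∀ S : Set V, walkVerts c n ⊆ S →
    (∀ x ∈ T, x ∈ S → ∀ y ∈ T, y ∈ S → ∀ p ∈ T, p ∈ G.geodInterval x y → p ∈ S) → T ⊆ S

theorem IsCroftonSet.perimeter_le {T : Set V} (hT : G.IsCroftonSet c n T) {u v w : V}
    (hu : u ∈ T) (hv : v ∈ T) (hw : w ∈ T) : G.perimeter u v w ≤ n :=
  perimeter_le_of_two_mul_dist_eq (hT.dist_eq u hu v hv) (hT.dist_eq u hu w hw)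
    (hT.dist_eq v hv w hw)

theorem IsGeodesicTriangle.isCroftonSet (hb : G.IsBipartite) (hc : G.Connected)
    (hT : G.IsGeodesicTriangle c k l n) (hr : G.ClosersConvexUpTo r) (hn : n ≤ r) :
    G.IsCroftonSet c n (walkVerts c n) := by
  -- The formula moves along the walk from `c j`; the ends of each step are themselves walk vertices
  -- on the two sides.
  have key : ∀ j m, j + m ≤ n →
      2 * G.dist (c (j + m)) (c j) = G.sepCount c n (c (j + m)) (c j) := by
    intro j m
    induction m with
    | zero => intro _; rw [Nat.add_zero, dist_self, sepCount_self]
    | succ m ih =>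
      intro hm
      have hadj := hT.adj (j + m) (by omega)
      refine hT.two_mul_dist_eq hb hc hr hadj (S := walkVerts c n) ?_ subset_rfl
        ⟨_, ⟨j + m, by omega, rfl⟩, left_mem_closerSet hadj⟩
        ⟨_, ⟨j + m + 1, by omega, rfl⟩, right_notMem_closerSet⟩ ⟨j, by omega, rfl⟩
        (ih (by omega))
      intro x hx y hy
      exact (hT.perimeter_le hc ⟨j + m, by omega, rfl⟩ hx hy).trans hn
  refine ⟨subset_rfl, ?_, fun S hS _ => hS⟩
  rintro _ ⟨i, hi, rfl⟩ _ ⟨j, hj, rfl⟩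
  rcases le_total i j with h | h
  · obtain ⟨m, rfl⟩ := Nat.exists_eq_add_of_le h
    rw [dist_comm, sepCount_comm]
    exact key i m hj
  · obtain ⟨m, rfl⟩ := Nat.exists_eq_add_of_le h
    exact key j m hi

theorem IsCroftonSet.sUnion {𝒞 : Set (Set V)} (h : ∀ T ∈ 𝒞, G.IsCroftonSet c n T)
    (hchain : IsChain (· ⊆ ·) 𝒞) (hne : 𝒞.Nonempty) : G.IsCroftonSet c n (⋃₀ 𝒞) := by
  obtain ⟨T₀, hT₀⟩ := hne
  refine ⟨(h T₀ hT₀).subset.trans (Set.subset_sUnion_of_mem hT₀), ?_, ?_⟩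
  · rintro u ⟨s, hs, hu⟩ v ⟨t, ht, hv⟩
    rcases hchain.total hs ht with hst | hts
    · exact (h t ht).dist_eq u (hst hu) v hv
    · exact (h s hs).dist_eq u hu v (hts hv)
  · rintro S hS hcl z ⟨T, hT, hz⟩
    refine (h T hT).generated S hS (fun x hx hxS y hy hyS p hp => ?_) hz
    exact hcl x ⟨T, hT, hx⟩ hxS y ⟨T, hT, hy⟩ hyS p ⟨T, hT, hp⟩

theorem IsCroftonSet.insert {T : Set V} (hT : G.IsCroftonSet c n T) {u v z : V} (hu : u ∈ T)
    (hv : v ∈ T) (hz : z ∈ G.geodInterval u v)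
    (hd : ∀ t ∈ T, 2 * G.dist z t = G.sepCount c n z t) : G.IsCroftonSet c n (insert z T) := by
  refine ⟨hT.subset.trans (Set.subset_insert z T), ?_, ?_⟩
  · rintro x (rfl | hx) y (rfl | hy)
    · rw [dist_self, sepCount_self]
    · exact hd y hy
    · rw [dist_comm, sepCount_comm]
      exact hd x hx
    · exact hT.dist_eq x hx y hy
  · intro S hS hcl
    have hTS : T ⊆ S := hT.generated S hS fun x hx hxS y hy hyS p hp =>
      hcl x (Or.inr hx) hxS y (Or.inr hy) hyS p (Or.inr hp)
    exact Set.insert_subset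
      (hcl u (Or.inr hu) (hTS hu) v (Or.inr hv) (hTS hv) z (Or.inl rfl) hz) hTS

/-- The separation formula extends from a Crofton set to the intervals between its elements. -/
theorem IsCroftonSet.two_mul_dist_eq (hb : G.IsBipartite) (hc : G.Connected)
    (hC : G.IsGeodesicTriangle c k l n) (hr : G.ClosersConvexUpTo r) (hn : n ≤ r) {T : Set V}
    (hT : G.IsCroftonSet c n T) {u v z : V} (hu : u ∈ T) (hv : v ∈ T)
    (hz : z ∈ G.geodInterval u v) : ∀ t ∈ T, 2 * G.dist z t = G.sepCount c n z t := by
  induction hm : G.dist z u generalizing z with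
  | zero =>
    obtain rfl := hc.dist_eq_zero_iff.1 hm
    exact hT.dist_eq z hu
  | succ m ih =>
    have hzu : z ≠ u := by rintro rfl; simp at hm
    -- The formula is carried from `u` to `z` along a geodesic, the last step being the edge `yz`.
    obtain ⟨y, hzy, hy⟩ := hc.exists_adj_dist_succ hzu
    rw [hc.mem_geodInterval_iff] at hz
    have h1 := hc.dist_triangle (u := y) (v := z) (w := v)
    have h2 := hc.dist_triangle (u := u) (v := y) (w := v)
    have h3 := dist_eq_one_iff_adj.2 hzy
    have h4 := G.dist_comm (u := u) (v := y)
    have h5 := G.dist_comm (u := u) (v := z)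
    have h6 := G.dist_comm (u := y) (v := z)
    have hyI : y ∈ G.geodInterval u v := hc.mem_geodInterval_iff.2 (by omega)
    have ihy := ih hyI (by omega)
    have hper : ∀ x ∈ T, ∀ x' ∈ T, G.perimeter y x x' ≤ r := fun x hx x' hx' =>
      (perimeter_le_of_two_mul_dist_eq (ihy x hx) (ihy x' hx') (hT.dist_eq x hx x' hx')).trans hn
    have huy : u ∈ G.closerSet y z := by rw [mem_closerSet]; omega
    have hvy : v ∉ G.closerSet y z := by
      rw [mem_closerSet, G.dist_comm (u := v), G.dist_comm (u := v)]; omega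
    intro t ht
    -- The edge `yz` separates `u` from `v`. If the walk lay on one side of it, `generated` would
    -- put all of `T` on that side.
    refine hC.two_mul_dist_eq hb hc hr hzy.symm hper hT.subset ?_ ?_ ht (ihy t ht)
    · by_contra! hne
      refine hT.generated (G.closerSet y z)ᶜ hne (fun x hx hxS x' hx' hxS' p _ hp => ?_) hu huy
      exact mt (hr.mem_iff hb hc hzy.symm hper hx hx' (iff_of_false hxS hxS') hp).1 hxS
    · by_contra! hne
      refine hvy (hT.generated (G.closerSet y z) hne (fun x hx hxS x' hx' hxS' p _ hp => ?_) hv)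
      exact (hr.mem_iff hb hc hzy.symm hper hx hx' (iff_of_true hxS hxS') hp).2 hxS

theorem IsGeodesicTriangle.exists_geodConvex (hb : G.IsBipartite) (hc : G.Connected)
    (hC : G.IsGeodesicTriangle c k l n) (hr : G.ClosersConvexUpTo r) (hn : n ≤ r) :
    ∃ T, G.IsCroftonSet c n T ∧ G.GeodConvex T := by
  obtain ⟨T, -, hT⟩ := zorn_subset_nonempty {T | G.IsCroftonSet c n T}
    (fun 𝒞 h𝒞 hch hne => ⟨⋃₀ 𝒞, IsCroftonSet.sUnion h𝒞 hch hne,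
      fun s hs => Set.subset_sUnion_of_mem hs⟩) _ (hC.isCroftonSet hb hc hr hn)
  refine ⟨T, hT.prop, fun u hu v hv z hz => ?_⟩
  have hins : G.IsCroftonSet c n (insert z T) :=
    hT.prop.insert hu hv hz (hT.prop.two_mul_dist_eq hb hc hC hr hn hu hv hz)
  exact hT.2 hins (Set.subset_insert z T) (Set.mem_insert z T)

/-- Three vertices of small perimeter that lie on the side of `p` of an edge `pa` are contained in
a convex set that does not contain `a`. -/
theorem ClosersConvexUpTo.exists_geodConvex (hb : G.IsBipartite) (hc : G.Connected)
    (hr : G.ClosersConvexUpTo r) {p a q t : V} (hpa : G.Adj p a) (hq : q ∈ G.closerSet p a)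
    (ht : t ∈ G.closerSet p a) (hper : G.perimeter p q t ≤ r) :
    ∃ T, G.GeodConvex T ∧ p ∈ T ∧ q ∈ T ∧ t ∈ T ∧ a ∉ T := by
  obtain ⟨c, k, l, hC, rfl, rfl, rfl⟩ := hc.exists_isGeodesicTriangle p q t
  obtain ⟨T, hT, hconv⟩ := hC.exists_geodConvex hb hc hr hper
  have hle₁ := hC.le₁
  have hle₂ := hC.le₂
  have h0 : c 0 ∈ walkVerts c (G.perimeter (c 0) (c k) (c l)) := ⟨0, Nat.zero_le _, rfl⟩
  have hmem : ∀ i ≤ G.perimeter (c 0) (c k) (c l), c i ∈ T := fun i hi => hT.subset ⟨i, hi, rfl⟩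
  have hp := left_mem_closerSet hpa
  have hint : ∀ x ∈ T, x ∈ G.closerSet (c 0) a → ∀ y ∈ T, y ∈ G.closerSet (c 0) a →
      G.geodInterval x y ⊆ G.closerSet (c 0) a := fun x hx hxa y hy hya =>
    hr _ _ hpa x hxa y hya ((hT.perimeter_le (hT.subset h0) hx hy).trans hper)
  -- Perimeters within `T` are at most `r`, so W_{pa} is closed under intervals relative to `T`; it
  -- contains the three geodesics and hence all that they generate.
  have hTsub : T ⊆ G.closerSet (c 0) a := by
    refine hT.generated _ ?_ fun x hx hxa y hy hya z _ hz => hint x hx hxa y hy hya hz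
    rintro _ ⟨i, hi, rfl⟩
    rcases le_total i k with h1 | h1
    · exact hint _ (hmem 0 (by omega)) hp _ (hmem k (by omega)) hq
        (hC.mem_geodInterval hc (Nat.zero_le k) (by omega) hC.dist₁ le_rfl (Nat.zero_le i) h1
          le_rfl)
    rcases le_total i l with h2 | h2
    · exact hint _ (hmem k (by omega)) hq _ (hmem l (by omega)) ht
        (hC.mem_geodInterval hc hle₁ hle₂ hC.dist₂ le_rfl h1 h2 le_rfl)
    · exact hint _ (hmem l (by omega)) ht _ (hmem _ le_rfl) (by rw [hC.closed]; exact hp)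
        (hC.mem_geodInterval hc hle₂ le_rfl hC.dist₃ le_rfl h2 hi le_rfl)
  exact ⟨T, hconv, hmem 0 (by omega), hmem k (by omega), hmem l (by omega),
    fun ha => right_notMem_closerSet (hTsub ha)⟩

/-! ### From Att-convexity to convexity of W_{ab}. -/

/-- An edge `ab` with two further edges `uu'`, `vv'` crossing from the side of `a` to the side of
`b`, such that `u'` lies between `u` and `v`, obstructs Att-convexity, if `b`, `u'`, `v'` lie in a
convex set that does not contain `a`. -/
theorem AttConvex.false_of_crossing (hb : G.IsBipartite) (hc : G.Connected) (hatt : G.AttConvex)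
    {a b u u' v v' : V} {T : Set V} (hT : G.GeodConvex T) (hab : G.Adj a b)
    (hbT : b ∈ T) (huT : u' ∈ T) (hvT : v' ∈ T) (haT : a ∉ T) (hu : u ∈ G.closerSet a b)
    (hv : v ∈ G.closerSet a b) (hua : u ∈ G.geodInterval a u') (hva : v ∈ G.geodInterval a v')
    (huv : u' ∈ G.geodInterval u v) : False := by
  obtain ⟨K, hTK, hK⟩ := hT.exists_isCopointAt haT
  have hsub := hb.subset_closerSet hc hab.symm hK.prop.1 (hTK hbT) hK.prop.2
  -- A convex set strictly larger than `K` contains `a` and `w'`, hence also `w` between them.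
  have key : ∀ w w', w ∈ G.closerSet a b → w' ∈ T → w ∈ G.geodInterval a w' →
      G.IsCopointAt K w := by
    intro w w' hw hw' hww
    refine ⟨⟨hK.prop.1, fun h => (hb.notMem_closerSet hc hab).2 (hsub h) hw⟩, ?_⟩
    rintro C ⟨hC, hwC⟩ hKC
    by_contra hCK
    have haC : a ∈ C := by
      by_contra haC
      exact hCK (hK.2 ⟨hC, haC⟩ hKC)
    exact hwC (hC haC (hKC (hTK hw')) hww)
  have hmem : G.IsCopointAt K u' :=
    hatt K ⟨a, hK⟩ (key u u' hu huT hua) (key v v' hv hvT hva) huv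
  exact hmem.prop.2 (hTK huT)

theorem AttConvex.closersConvexUpTo (hb : G.IsBipartite) (hc : G.Connected) (hatt : G.AttConvex)
    (r : ℕ) : G.ClosersConvexUpTo r := by
  induction r using Nat.strong_induction_on with
  | _ r ih =>
    intro a b hab x hx y hy hper z hz
    by_contra hzW
    obtain ⟨u, hu, u', hu', huu, hxu⟩ := hc.exists_adj_crossing (G.closerSet a b) hx hzW
    obtain ⟨v, hv, v', hv', hvv, hyv⟩ := hc.exists_adj_crossing (G.closerSet a b) hy hzW
    rw [hc.mem_geodInterval_iff] at hz
    rw [hb.notMem_closerSet hc hab] at hu' hv'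
    have e1 := hb.dist_eq_of_mem_closerSet hc hab hu
    have e2 := hb.dist_eq_of_mem_closerSet hc hab hv
    have e3 := hb.dist_eq_of_mem_closerSet hc hab.symm hu'
    have e4 := hb.dist_eq_of_mem_closerSet hc hab.symm hv'
    have e5 := hb.dist_adj_cases hc huu a
    have e6 := hb.dist_adj_cases hc huu b
    have e7 := hb.dist_adj_cases hc hvv a
    have e8 := hb.dist_adj_cases hc hvv b
    have f1 := hc.dist_triangle (u := u') (v := z) (w := v')
    have f2 := hc.dist_triangle (u := x) (v := u) (w := y)
    have f3 := hc.dist_triangle (u := u) (v := v) (w := y)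
    have f4 := hc.dist_triangle (u := u) (v := u') (w := v)
    have f5 := hc.dist_triangle (u := u') (v := v') (w := v)
    have f6 := hc.dist_triangle (u := a) (v := x) (w := u)
    have f7 := hc.dist_triangle (u := a) (v := y) (w := v)
    have g1 := dist_eq_one_iff_adj.2 huu
    have g2 := dist_eq_one_iff_adj.2 hvv.symm
    have c1 := G.dist_comm (u := z) (v := y)
    have c2 := G.dist_comm (u := z) (v := v')
    have c3 := G.dist_comm (u := v) (v := y)
    have c4 := G.dist_comm (u := a) (v := u)
    have c5 := G.dist_comm (u := a) (v := v)
    have c6 := G.dist_comm (u := a) (v := u')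
    have c7 := G.dist_comm (u := a) (v := v')
    have c8 := G.dist_comm (u := b) (v := u')
    have c9 := G.dist_comm (u := b) (v := v')
    have c10 := G.dist_comm (u := b) (v := u)
    have c11 := G.dist_comm (u := b) (v := v)
    have c12 := G.dist_comm (u := v) (v := v')
    unfold perimeter at hper
    -- Here `b` is as far from `u'` and `v'` as `a` is from `u` and `v`. Going through `x`, `y` and
    -- `z` bounds the new perimeter by the old one minus the two edges `uu'` and `vv'`.
    have hper' : G.perimeter b u' v' ≤ r - 1 := by
      unfold perimeter
      omega
    obtain ⟨T, hT, hbT, huT, hvT, haT⟩ :=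
      (ih (r - 1) (by omega)).exists_geodConvex hb hc hab.symm hu' hv' hper'
    refine hatt.false_of_crossing hb hc hT hab hbT huT hvT haT hu hv
      (hc.mem_geodInterval_iff.2 ?_) (hc.mem_geodInterval_iff.2 ?_) (hc.mem_geodInterval_iff.2 ?_)
    all_goals omega

end SimpleGraph

theorem theoremT {V : Type*} (G : SimpleGraph V) (hconn : G.Connected) (hbip : G.IsBipartite) :
    G.IsPartialCube ↔ G.AttConvex := by
  classical
  constructor
  · intro h
    obtain ⟨ι, f, hf⟩ := h.exists_dist_eq
    exact SimpleGraph.attConvex_of_geodConvex_closerSet hbip hconn fun a b hab =>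
      SimpleGraph.geodConvex_closerSet_of_dist_eq hconn f hf hab
  · intro h
    exact SimpleGraph.isPartialCube_of_geodConvex_closerSet hbip hconn fun a b hab x hx y hy =>
      h.closersConvexUpTo hbip hconn _ a b hab x hx y hy le_rfl
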